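/- A set partition $\pi$ of a finite set $S$ (written $\pi\vdash S$) is a set of disjoint nonempty blocks with union $S$; $\ell(\pi)$ is the number of its blocks, and $\sigma\le\pi$ means that every block of $\sigma$ is contained in a block of $\pi$. Let $[n]=\{1,\dots,n\}$, let $\mu$ be the Möbius function of the lattice of set partitions of $[n]$, and let $[[n]]$ be the set partition of $[n]$ with one block (with no block if $n=0$). For $\pi\vdash[n]$ and $S\subseteq[n]$ let $\pi|_S\vdash S$ consist of the nonempty intersections of blocks of $\pi$ with $S$, and let $\mathrm{St}(\pi|_S)\vdash[|S|]$ be its image under the order preserving bijection $S\to[|S|]$. We write $[n]=S_1\sqcup S_2$ for an ordered pair of disjoint, possibly empty sets with union $[n]$, and $\nu=\nu|_{S_1}\sqcup\nu|_{S_2}$ if the blocks of $\nu$ are those of $\nu|_{S_1}$ together with those of $\nu|_{S_2}$. Let $\mathrm{NCSym}\subset\mathbb{Q}[[\mathbf{x}_1,\mathbf{x}_2,\dots]]$ be the algebra of power series of bounded degree in noncommuting variables that are invariant under permutations of the variables. It has the basis of all $p_\pi$, $\pi\vdash[n]$, $n\ge 0$, where $p_\pi=\sum \mathbf{x}_{i_1}\cdots\mathbf{x}_{i_n}$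 over all $(i_1,\dots,i_n)$ with $i_j=i_k$ whenever $j,k$ lie in the same block of $\pi$. Its coproduct is the linear map $\Delta:\mathrm{NCSym}\to\mathrm{NCSym}\otimes\mathrm{NCSym}$ with $$\Delta(p_\pi)=\sum_{\substack{[n]=S_1\sqcup S_2\\ \pi=\pi|_{S_1}\sqcup\pi|_{S_2}}}p_{\mathrm{St}(\pi|_{S_1})}\otimes p_{\mathrm{St}(\pi|_{S_2})}.$$ For $\pi\vdash[n]$ put $x_\pi=\sum_{\sigma\le\pi}\mu(\sigma,\pi)\,p_\sigma$. **Corollary.** The $x_\pi$ ($\pi\vdash[n]$, $n\ge0$) form a basis of $\mathrm{NCSym}$, and the following hold. 1. For $n\ge1$ and all set partitions $\sigma\vdash[k]$, $\tau\vdash[l]$, the coefficient of $x_\sigma\otimes x_\tau$ in $\Delta(x_{[[n]]})$ is $$\sum_{\substack{\nu\vdash[n],\ [n]=S_1\sqcup S_2,\ \nu=\nu|_{S_1}\sqcup\nu|_{S_2},\\ \sigma\le\mathrm{St}(\nu|_{S_1}),\ \tau\le\mathrm{St}(\nu|_{S_2})}}(-1)^{\ell(\nu)-1}(\ell(\nu)-1)!,$$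 where the inequalities include the conditions $|S_1|=k$ and $|S_2|=l$. 2. $x_\pi x_\rho=x_{\pi|\rho}$ for $\pi\vdash[n]$, $\rho\vdash[m]$, where $\pi|\rho\vdash[n+m]$ consists of the blocks of $\pi$ and the blocks of $\rho$ shifted by $n$; and $\Delta(fg)=\Delta(f)\Delta(g)$ for all $f,g\in\mathrm{NCSym}$. 3. $\eta\circ x_\pi=x_{\eta(\pi)}$ for $\pi\vdash[n]$ and $\eta\in\mathfrak{S}_n$, where $\eta(\pi)$ replaces each $i$ by $\eta(i)$ in $\pi$, and $\eta\circ(\mathbf{x}_{i_1}\cdots\mathbf{x}_{i_n})=\mathbf{x}_{i_{\eta^{-1}(1)}}\cdots\mathbf{x}_{i_{\eta^{-1}(n)}}$, extended linearly. 4. For every $n\ge0$, every $\pi\vdash[n]$ and all set partitions $\sigma\vdash[k]$, $\tau\vdash[l]$, the coefficient of $x_\sigma\otimes x_\tau$ in $\Delta(x_\pi)$ is $$\sum_{\substack{\nu\vdash[n],\ [n]=S_1\sqcup S_2,\ \nu\le\pi,\ \nu=\nu|_{S_1}\sqcup\nu|_{S_2},\\ \sigma\le\mathrm{St}(\nu|_{S_1}),\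 \tau\le\mathrm{St}(\nu|_{S_2})}}\mu(\nu,\pi).$$ -/

import Mathlib

open Finset
open scoped TensorProduct

namespace NCS

/-! ### Set partitions -/

/-- Set partitions of `[n]`, modelled on `Fin n = {0, …, n-1}`, ordered by refinement
(`σ ≤ π` iff every block of `σ` is contained in a block of `π`, Mathlib's order on finpartitions).
The greatest element `⊤` has the single block `[n]` (and no block if `n = 0`). -/
abbrev SetPartition (n : ℕ) : Type := Finpartition (univ : Finset (Fin n))

/-- All set partitions of all `[n]`, `n ≥ 0`. -/
abbrev AnySetPartition : Type := Σ n : ℕ, SetPartition n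

/-- The lattice of set partitions is finite, hence locally finite. -/
noncomputable instance instLocallyFiniteOrder (n : ℕ) : LocallyFiniteOrder (SetPartition n) :=
  letI : DecidableLE (SetPartition n) := Classical.decRel _
  letI : DecidableLT (SetPartition n) := Classical.decRel _
  Fintype.toLocallyFiniteOrder

/-- The Möbius function `μ(σ, π)` of the lattice of set partitions of `[n]`. -/
noncomputable def moebius {n : ℕ} (σ π : SetPartition n) : ℚ := IncidenceAlgebra.mu ℚ σ π

/-- `j` and `k` lie in the same block of `π`. -/
def SameBlock {n : ℕ} (π : SetPartition n) (j k : Fin n) : Prop :=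
  ∃ B ∈ π.parts, j ∈ B ∧ k ∈ B

/-- The restriction `π|_S`: its blocks are the nonempty intersections of blocks of `π` with `S`. -/
def restr {n : ℕ} (π : SetPartition n) (S : Finset (Fin n)) : Finpartition S :=
  π.restrict (subset_univ S)

/-- `π = π|_S ⊔ π|_{Sᶜ}`: the blocks of `π` are those of `π|_S` together with those of
`π|_{Sᶜ}`. -/
def Splits {n : ℕ} (π : SetPartition n) (S : Finset (Fin n)) : Prop :=
  π.parts = (restr π S).parts ∪ (restr π Sᶜ).parts

/-- Standardization: the partition of `[k]` obtained from a partition `A` of a `k`-element set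
`S` of integers through the order preserving bijection between `S` and `[k]`. -/
def standardize {n : ℕ} {S : Finset (Fin n)} {k : ℕ} (h : S.card = k) (A : Finpartition S) :
    SetPartition k :=
  Finpartition.ofExistsUnique
    (A.parts.image fun B => univ.filter fun j => S.orderEmbOfFin h j ∈ B)
    (fun _ _ => subset_univ _)
    (by
      intro j _
      obtain ⟨B, ⟨hB, hj⟩, huniq⟩ := A.existsUnique_mem (S.orderEmbOfFin_mem h j)
      refine ⟨univ.filter fun i => S.orderEmbOfFin h i ∈ B,
        ⟨mem_image_of_mem _ hB, by simpa using hj⟩, ?_⟩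
      rintro t ⟨ht, hjt⟩
      obtain ⟨C, hC, rfl⟩ := mem_image.1 ht
      have hC' : C = B := huniq C ⟨hC, by simpa using hjt⟩
      rw [hC'])
    (by
      intro h0
      obtain ⟨B, hB, hB0⟩ := mem_image.1 h0
      obtain ⟨b, hb⟩ := A.nonempty_of_mem_parts hB
      have hbS : b ∈ Set.range (S.orderEmbOfFin h) := by
        rw [S.range_orderEmbOfFin h]
        exact A.subset hB hb
      obtain ⟨j, rfl⟩ := hbS
      have hj : j ∈ univ.filter fun i => S.orderEmbOfFin h i ∈ B := by simpa using hb
      rw [hB0] at hj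
      simp at hj)

/-- `St(π|_S)` as a set partition of `[|S|]`. -/
def stRestr {n : ℕ} (π : SetPartition n) (S : Finset (Fin n)) : AnySetPartition :=
  ⟨S.card, standardize rfl (restr π S)⟩

/-- `σ ≤ St(π|_S)`, where `σ` is a set partition of `[k]`; in particular `|S| = k`. -/
def LeStRestr {n k : ℕ} (σ : SetPartition k) (π : SetPartition n) (S : Finset (Fin n)) : Prop :=
  ∃ h : S.card = k, σ ≤ standardize h (restr π S)

/-- The slash product `π|σ`: the blocks of `π` together with the blocks of `σ` shifted by `n`. -/
def slash {n m : ℕ} (π : SetPartition n) (σ : SetPartition m) : SetPartition (n + m) :=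
  Finpartition.ofExistsUnique
    ((π.parts.image fun B => B.map (Fin.castAddEmb m)) ∪
      (σ.parts.image fun B => B.map (Fin.natAddEmb n)))
    (fun _ _ => subset_univ _)
    (by
      intro a _
      refine Fin.addCases (fun i => ?_) (fun i => ?_) a
      · obtain ⟨B, ⟨hB, hi⟩, huniq⟩ := π.existsUnique_mem (mem_univ i)
        refine ⟨B.map (Fin.castAddEmb m),
          ⟨mem_union_left _ (mem_image_of_mem _ hB), by simpa using hi⟩, ?_⟩
        rintro t ⟨ht, hit⟩
        rcases mem_union.1 ht with ht | ht
        · obtain ⟨C, hC, rfl⟩ := mem_image.1 ht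
          rw [huniq C ⟨hC, by simpa using hit⟩]
        · obtain ⟨C, hC, rfl⟩ := mem_image.1 ht
          obtain ⟨x, _, hx⟩ := mem_map.1 hit
          have := congrArg Fin.val hx
          simp at this
          omega
      · obtain ⟨B, ⟨hB, hi⟩, huniq⟩ := σ.existsUnique_mem (mem_univ i)
        refine ⟨B.map (Fin.natAddEmb n),
          ⟨mem_union_right _ (mem_image_of_mem _ hB), by simpa using hi⟩, ?_⟩
        rintro t ⟨ht, hit⟩
        rcases mem_union.1 ht with ht | ht
        · obtain ⟨C, hC, rfl⟩ := mem_image.1 ht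
          obtain ⟨x, _, hx⟩ := mem_map.1 hit
          have := congrArg Fin.val hx
          simp at this
          omega
        · obtain ⟨C, hC, rfl⟩ := mem_image.1 ht
          rw [huniq C ⟨hC, by simpa using hit⟩])
    (by
      intro h0
      rcases mem_union.1 h0 with h0 | h0
      · obtain ⟨B, hB, hB0⟩ := mem_image.1 h0
        exact π.ne_empty hB (map_eq_empty.1 hB0)
      · obtain ⟨B, hB, hB0⟩ := mem_image.1 h0
        exact σ.ne_empty hB (map_eq_empty.1 hB0))

/-- `η(π)`: the set partition obtained by replacing every `i` with `η(i)` in `π`. -/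
def permute {n : ℕ} (η : Equiv.Perm (Fin n)) (π : SetPartition n) : SetPartition n :=
  Finpartition.ofExistsUnique
    (π.parts.image fun B => B.map η.toEmbedding)
    (fun _ _ => subset_univ _)
    (by
      intro a _
      obtain ⟨B, ⟨hB, hi⟩, huniq⟩ := π.existsUnique_mem (mem_univ (η.symm a))
      refine ⟨B.map η.toEmbedding,
        ⟨mem_image_of_mem _ hB, mem_map.2 ⟨η.symm a, hi, by simp⟩⟩, ?_⟩
      rintro t ⟨ht, hit⟩
      obtain ⟨C, hC, rfl⟩ := mem_image.1 ht
      obtain ⟨x, hx, rfl⟩ := mem_map.1 hit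
      rw [huniq C ⟨hC, by simpa using hx⟩])
    (by
      intro h0
      obtain ⟨B, hB, hB0⟩ := mem_image.1 h0
      exact π.ne_empty hB (map_eq_empty.1 hB0))

/-! ### Formal power series in noncommuting variables -/

/-- `ℚ[[x₀, x₁, …]]` in countably many noncommuting variables: the series `f` has coefficient
`f [i₁, …, iₙ]` at the monomial `x_{i₁} ⋯ x_{iₙ}`. -/
def NCPowerSeries : Type := List ℕ → ℚ

namespace NCPowerSeries

noncomputable instance : AddCommGroup NCPowerSeries := inferInstanceAs (AddCommGroup (List ℕ → ℚ))

noncomputable instance : Module ℚ NCPowerSeries := inferInstanceAs (Module ℚ (List ℕ → ℚ))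

/-- The coefficient of a product at a word is the sum over all ways to cut the word in two. -/
noncomputable instance : Mul NCPowerSeries :=
  ⟨fun f g w => ∑ k ∈ range (w.length + 1), f (w.take k) * g (w.drop k)⟩

noncomputable instance : One NCPowerSeries := ⟨fun w => if w = [] then 1 else 0⟩

theorem add_coeff (f g : NCPowerSeries) (w : List ℕ) : (f + g) w = f w + g w := rfl

theorem zero_coeff (w : List ℕ) : (0 : NCPowerSeries) w = 0 := rfl

theorem smul_coeff (c : ℚ) (f : NCPowerSeries) (w : List ℕ) : (c • f) w = c * f w := rfl

theorem one_coeff (w : List ℕ) : (1 : NCPowerSeries) w = if w = [] then 1 else 0 := rfl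

theorem mul_coeff (f g : NCPowerSeries) (w : List ℕ) :
    (f * g) w = ∑ k ∈ range (w.length + 1), f (w.take k) * g (w.drop k) := rfl

theorem sum_coeff {ι : Type*} (s : Finset ι) (f : ι → NCPowerSeries) (w : List ℕ) :
    (∑ i ∈ s, f i) w = ∑ i ∈ s, f i w :=
  Finset.sum_apply (M := fun _ : List ℕ => ℚ) w s f

theorem ext' {f g : NCPowerSeries} (h : ∀ w, f w = g w) : f = g := funext h

protected theorem mul_assoc (f g h : NCPowerSeries) : f * g * h = f * (g * h) := by
  refine ext' fun w => ?_
  simp only [mul_coeff, Finset.sum_mul, Finset.mul_sum]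
  rw [Finset.sum_sigma', Finset.sum_sigma']
  refine Finset.sum_bij' (fun p _ => ⟨p.2, p.1 - p.2⟩) (fun p _ => ⟨p.1 + p.2, p.1⟩) ?_ ?_ ?_ ?_ ?_
  · rintro ⟨k, j⟩ hp
    simp only [mem_sigma, mem_range, List.length_take, List.length_drop] at hp ⊢
    omega
  · rintro ⟨k, j⟩ hp
    simp only [mem_sigma, mem_range, List.length_take, List.length_drop] at hp ⊢
    omega
  · rintro ⟨k, j⟩ hp
    simp only [mem_sigma, mem_range, List.length_take] at hp ⊢
    simp only [Sigma.mk.injEq, heq_eq_eq, and_true]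
    omega
  · rintro ⟨k, j⟩ hp
    simp
  · rintro ⟨k, j⟩ hp
    simp only [mem_sigma, mem_range, List.length_take] at hp
    have h1 : j ≤ k := by omega
    rw [List.take_take, min_eq_left h1, List.drop_drop, Nat.add_sub_cancel' h1, mul_assoc,
      List.drop_take]

noncomputable instance : Ring NCPowerSeries :=
  { (inferInstance : AddCommGroup NCPowerSeries) with
    mul := (· * ·)
    one := 1
    mul_assoc := NCPowerSeries.mul_assoc
    one_mul := by
      intro f
      refine ext' fun w => ?_
      rw [mul_coeff, Finset.sum_eq_single 0]
      · simp [one_coeff]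
      · intro k hk hk0
        have : w.take k ≠ [] := by
          rw [ne_eq, List.take_eq_nil_iff]
          rintro (h | h)
          · exact hk0 h
          · subst h
            simp at hk
            omega
        simp [one_coeff, this]
      · simp
    mul_one := by
      intro f
      refine ext' fun w => ?_
      rw [mul_coeff, Finset.sum_eq_single w.length]
      · simp [one_coeff]
      · intro k hk hk0
        have : w.drop k ≠ [] := by
          rw [ne_eq, List.drop_eq_nil_iff]
          simp at hk
          omega
        simp [one_coeff, this]
      · simp
    left_distrib := by
      intro f g h
      refine ext' fun w => ?_
      simp only [mul_coeff, add_coeff, mul_add, Finset.sum_add_distrib]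
    right_distrib := by
      intro f g h
      refine ext' fun w => ?_
      simp only [mul_coeff, add_coeff, add_mul, Finset.sum_add_distrib]
    zero_mul := by
      intro f
      refine ext' fun w => ?_
      simp [mul_coeff, zero_coeff]
    mul_zero := by
      intro f
      refine ext' fun w => ?_
      simp [mul_coeff, zero_coeff] }

noncomputable instance : Algebra ℚ NCPowerSeries :=
  Algebra.ofModule
    (by
      intro c f g
      refine ext' fun w => ?_
      simp only [mul_coeff, smul_coeff, Finset.mul_sum, mul_assoc])
    (by
      intro c f g
      refine ext' fun w => ?_
      simp only [mul_coeff, smul_coeff, Finset.mul_sum, mul_left_comm])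

/-- The action `η ∘ (x_{i₁} ⋯ x_{iₙ}) = x_{i_{η⁻¹(1)}} ⋯ x_{i_{η⁻¹(n)}}` of `η ∈ 𝔖ₙ` on the
monomials of degree `n`, extended linearly to series; monomials of other degrees are kept.
Thus the coefficient of `η ∘ f` at `x_{i₁} ⋯ x_{iₙ}` is that of `f` at
`x_{i_{η(1)}} ⋯ x_{i_{η(n)}}`. -/
noncomputable def permAct {n : ℕ} (η : Equiv.Perm (Fin n)) (f : NCPowerSeries) : NCPowerSeries :=
  fun w => if h : w.length = n then f (List.ofFn fun j : Fin n => w.get ((η j).cast h.symm))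
    else f w

end NCPowerSeries

open NCPowerSeries

/-! ### Symmetric functions in noncommuting variables -/

/-- `NCSym`: the series of bounded degree that are invariant under all permutations of the
variables. -/
noncomputable def NCSym : Subalgebra ℚ NCPowerSeries where
  carrier := {f | (∃ N : ℕ, ∀ w : List ℕ, N < w.length → f w = 0) ∧
    ∀ (ρ : Equiv.Perm ℕ) (w : List ℕ), f (w.map ρ) = f w}
  mul_mem' := by
    rintro f g ⟨⟨N, hN⟩, hf⟩ ⟨⟨M, hM⟩, hg⟩
    refine ⟨⟨N + M, fun w hw => ?_⟩, fun ρ w => ?_⟩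
    · rw [mul_coeff]
      refine Finset.sum_eq_zero fun k hk => ?_
      rw [mem_range] at hk
      by_cases h : N < k
      · rw [hN _ (by rw [List.length_take]; omega), zero_mul]
      · rw [hM _ (by rw [List.length_drop]; omega), mul_zero]
    · simp only [mul_coeff, List.length_map, ← List.map_take, ← List.map_drop, hf, hg]
  add_mem' := by
    rintro f g ⟨⟨N, hN⟩, hf⟩ ⟨⟨M, hM⟩, hg⟩
    refine ⟨⟨max N M, fun w hw => ?_⟩, fun ρ w => ?_⟩
    · rw [add_coeff, hN w (lt_of_le_of_lt (le_max_left _ _) hw),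
        hM w (lt_of_le_of_lt (le_max_right _ _) hw), add_zero]
    · rw [add_coeff, add_coeff, hf, hg]
  algebraMap_mem' := by
    intro c
    rw [Algebra.algebraMap_eq_smul_one]
    refine ⟨⟨0, fun w hw => ?_⟩, fun ρ w => ?_⟩
    · have : w ≠ [] := by rintro rfl; simp at hw
      simp [smul_coeff, one_coeff, this]
    · simp [smul_coeff, one_coeff]

/-- The series `m_π = ∑ x_{i₁} ⋯ x_{iₙ}` over all `(i₁, …, iₙ)` with `i_j = i_k` if and only if
`j` and `k` lie in the same block of `π`. -/
noncomputable def mSeries {n : ℕ} (π : SetPartition n) : NCPowerSeries := by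
  classical
  exact fun w => if ∃ i : Fin n → ℕ, w = List.ofFn i ∧ ∀ j k, i j = i k ↔ SameBlock π j k
    then 1 else 0

/-- The series `p_π = ∑ x_{i₁} ⋯ x_{iₙ}` over all `(i₁, …, iₙ)` with `i_j = i_k` if
`j` and `k` lie in the same block of `π`. -/
noncomputable def pSeries {n : ℕ} (π : SetPartition n) : NCPowerSeries := by
  classical
  exact fun w => if ∃ i : Fin n → ℕ, w = List.ofFn i ∧ ∀ j k, SameBlock π j k → i j = i k
    then 1 else 0

theorem mSeries_ofFn {n : ℕ} (π : SetPartition n) (i : Fin n → ℕ) [Decidable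
    (∀ j k, i j = i k ↔ SameBlock π j k)] :
    mSeries π (List.ofFn i) = if ∀ j k, i j = i k ↔ SameBlock π j k then 1 else 0 := by
  classical
  unfold mSeries
  refine if_congr ⟨?_, fun h => ⟨i, rfl, h⟩⟩ rfl rfl
  rintro ⟨i', h, h'⟩
  rw [List.ofFn_injective h]
  exact h'

theorem pSeries_ofFn {n : ℕ} (π : SetPartition n) (i : Fin n → ℕ) [Decidable
    (∀ j k, SameBlock π j k → i j = i k)] :
    pSeries π (List.ofFn i) = if ∀ j k, SameBlock π j k → i j = i k then 1 else 0 := by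
  classical
  unfold pSeries
  refine if_congr ⟨?_, fun h => ⟨i, rfl, h⟩⟩ rfl rfl
  rintro ⟨i', h, h'⟩
  rw [List.ofFn_injective h]
  exact h'

theorem mSeries_of_length_ne {n : ℕ} (π : SetPartition n) (w : List ℕ) (h : w.length ≠ n) :
    mSeries π w = 0 := by
  unfold mSeries
  refine if_neg ?_
  rintro ⟨i, rfl, -⟩
  simp at h

theorem pSeries_of_length_ne {n : ℕ} (π : SetPartition n) (w : List ℕ) (h : w.length ≠ n) :
    pSeries π w = 0 := by
  unfold pSeries
  refine if_neg ?_
  rintro ⟨i, rfl, -⟩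
  simp at h

/-- Every word is the word of its letters. -/
theorem exists_ofFn {n : ℕ} (w : List ℕ) (h : w.length = n) : ∃ i : Fin n → ℕ, w = List.ofFn i := by
  subst h
  exact ⟨w.get, (List.ofFn_get w).symm⟩

theorem pSeries_mem {n : ℕ} (π : SetPartition n) : pSeries π ∈ NCSym := by
  classical
  refine ⟨⟨n, fun w hw => pSeries_of_length_ne π w hw.ne'⟩, fun ρ w => ?_⟩
  by_cases h : w.length = n
  · obtain ⟨i, rfl⟩ := exists_ofFn w h
    rw [List.map_ofFn, pSeries_ofFn, pSeries_ofFn]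
    simp
  · rw [pSeries_of_length_ne π w h, pSeries_of_length_ne π _ (by simpa using h)]

/-- The power sum symmetric function `p_π` in `NCSym`. -/
noncomputable def p {n : ℕ} (π : SetPartition n) : NCSym := ⟨pSeries π, pSeries_mem π⟩

/-- The extra symmetric function `x_π = ∑_{σ ≤ π} μ(σ, π) p_σ` in `NCSym`. -/
noncomputable def x {n : ℕ} (π : SetPartition n) : NCSym := by
  classical
  exact ∑ σ : SetPartition n with σ ≤ π, moebius σ π • p σ

/-! ### The `p`-basis and the coproduct -/

theorem sameBlock_iff {n : ℕ} (π : SetPartition n) (j k : Fin n) :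
    SameBlock π j k ↔ π.part j = π.part k := by
  constructor
  · rintro ⟨B, hB, hj, hk⟩
    rw [π.part_eq_of_mem hB hj, π.part_eq_of_mem hB hk]
  · intro h
    exact ⟨π.part j, π.part_mem.2 (mem_univ j), π.mem_part_self.2 (mem_univ j),
      h ▸ π.mem_part_self.2 (mem_univ k)⟩

theorem le_iff_sameBlock {n : ℕ} (σ π : SetPartition n) :
    σ ≤ π ↔ ∀ j k, SameBlock σ j k → SameBlock π j k := by
  constructor
  · rintro h j k ⟨B, hB, hj, hk⟩
    obtain ⟨C, hC, hBC⟩ := h hB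
    exact ⟨C, hC, hBC hj, hBC hk⟩
  · intro h B hB
    obtain ⟨b, hb⟩ := σ.nonempty_of_mem_parts hB
    refine ⟨π.part b, π.part_mem.2 (mem_univ b), fun c hc => ?_⟩
    have := (sameBlock_iff π b c).1 (h b c ⟨B, hB, hb, hc⟩)
    rw [this]
    exact π.mem_part_self.2 (mem_univ c)

/-- A word in which two letters agree exactly when their positions lie in one block of `π`. -/
noncomputable def word {n : ℕ} (π : SetPartition n) : Fin n → ℕ :=
  fun j => Encodable.encode (π.part j)

theorem word_eq_iff {n : ℕ} (π : SetPartition n) (j k : Fin n) :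
    word π j = word π k ↔ SameBlock π j k := by
  rw [sameBlock_iff, word, word, Encodable.encode_inj]

/-- Every word is constant exactly on the blocks of some set partition of its positions. -/
theorem exists_kernel {n : ℕ} (i : Fin n → ℕ) :
    ∃ π : SetPartition n, ∀ j k, i j = i k ↔ SameBlock π j k := by
  classical
  refine ⟨Finpartition.ofSetoid (Setoid.ker i), fun j k => ?_⟩
  rw [sameBlock_iff, ← Finpartition.mem_part_iff_part_eq_part _ (mem_univ j) (mem_univ k),
    Finpartition.mem_part_ofSetoid_iff_rel, Setoid.ker_def]
  exact eq_comm

theorem p_word {n : ℕ} (π σ : SetPartition n) [Decidable (π ≤ σ)] :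
    (p π : NCPowerSeries) (List.ofFn (word σ)) = if π ≤ σ then 1 else 0 := by
  classical
  change pSeries π _ = _
  rw [pSeries_ofFn]
  refine if_congr ?_ rfl rfl
  simp only [word_eq_iff, le_iff_sameBlock]

theorem p_linearIndependent :
    LinearIndependent ℚ (fun a : AnySetPartition => p a.2) := by
  classical
  rw [linearIndependent_iff']
  intro s g hg
  have key : ∀ (n : ℕ) (π : SetPartition n), (⟨n, π⟩ : AnySetPartition) ∈ s →
      g ⟨n, π⟩ = 0 := by
    intro n π
    induction π using WellFoundedLT.induction with
    | _ π ih =>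
      intro hπ
      have h := congrArg (fun f : NCSym => (f : NCPowerSeries) (List.ofFn (word π))) hg
      simp only [AddSubmonoidClass.coe_finsetSum, sum_coeff, Subalgebra.coe_smul, smul_coeff,
        ZeroMemClass.coe_zero, zero_coeff] at h
      rw [Finset.sum_eq_single (⟨n, π⟩ : AnySetPartition)] at h
      · simpa [p_word] using h
      · rintro ⟨m, σ⟩ hσ hne
        by_cases hm : m = n
        · subst hm
          rw [p_word]
          by_cases hle : σ ≤ π
          · rw [ih σ (lt_of_le_of_ne hle (by rintro rfl; exact hne rfl)) hσ, zero_mul]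
          · rw [if_neg hle, mul_zero]
        · change _ * pSeries σ _ = 0
          rw [pSeries_of_length_ne σ _ (by simpa using Ne.symm hm), mul_zero]
      · exact fun hn => absurd hπ hn
  rintro ⟨n, π⟩ h
  exact key n π h

/-- `p_π = ∑_{σ ≥ π} m_σ`. -/
theorem pSeries_eq_sum {n : ℕ} (π : SetPartition n) [DecidableLE (SetPartition n)] :
    pSeries π = ∑ σ : SetPartition n with π ≤ σ, mSeries σ := by
  classical
  refine ext' fun w => ?_
  rw [sum_coeff]
  by_cases h : w.length = n
  · obtain ⟨i, rfl⟩ := exists_ofFn w h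
    obtain ⟨τ, hτ⟩ := exists_kernel i
    have hm : ∀ σ : SetPartition n, mSeries σ (List.ofFn i) = if σ = τ then 1 else 0 := by
      intro σ
      rw [mSeries_ofFn]
      refine if_congr ?_ rfl rfl
      simp only [hτ]
      constructor
      · intro h
        exact le_antisymm ((le_iff_sameBlock _ _).2 fun j k => (h j k).2)
          ((le_iff_sameBlock _ _).2 fun j k => (h j k).1)
      · rintro rfl j k
        rfl
    simp only [hm, Finset.sum_ite_eq', mem_filter, mem_univ, true_and]
    rw [pSeries_ofFn]
    refine if_congr ?_ rfl rfl
    simp only [hτ, le_iff_sameBlock]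
  · rw [pSeries_of_length_ne π w h, Finset.sum_eq_zero]
    exact fun σ _ => mSeries_of_length_ne σ w h

theorem mSeries_mem_span {n : ℕ} (π : SetPartition n) :
    mSeries π ∈ Submodule.span ℚ (Set.range fun a : AnySetPartition => pSeries a.2) := by
  classical
  induction π using WellFoundedGT.induction with
  | _ π ih =>
    have h : pSeries π = mSeries π + ∑ σ : SetPartition n with π < σ, mSeries σ := by
      rw [pSeries_eq_sum, ← Finset.add_sum_erase _ _ (show π ∈ _ by simp)]
      congr 1
      refine Finset.sum_congr ?_ fun _ _ => rfl
      ext σ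
      simp only [mem_erase, mem_filter, mem_univ, true_and, lt_iff_le_and_ne]
      tauto
    rw [← sub_eq_iff_eq_add] at h
    rw [← h]
    refine Submodule.sub_mem _ (Submodule.subset_span ⟨⟨n, π⟩, rfl⟩)
      (Submodule.sum_mem _ fun σ hσ => ih σ (by simpa using hσ))

/-- A bijection between two finite sets of variables extends to a permutation of all variables. -/
theorem exists_perm {n : ℕ} (i i' : Fin n → ℕ) (h : ∀ j k, i j = i k ↔ i' j = i' k) :
    ∃ ρ : Equiv.Perm ℕ, ∀ j, ρ (i j) = i' j := by
  classical
  have hb : ∃ N, ∀ j, i j < N ∧ i' j < N := by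
    refine ⟨(∑ j, i j) + (∑ j, i' j) + 1, fun j => ?_⟩
    have h1 := Finset.single_le_sum (f := i) (fun _ _ => Nat.zero_le _) (mem_univ j)
    have h2 := Finset.single_le_sum (f := i') (fun _ _ => Nat.zero_le _) (mem_univ j)
    omega
  obtain ⟨N, hN⟩ := hb
  let a : Fin n → Fin N := fun j => ⟨i j, (hN j).1⟩
  let a' : Fin n → Fin N := fun j => ⟨i' j, (hN j).2⟩
  have ha : ∀ j k, a j = a k ↔ a' j = a' k := fun j k => by
    simp only [a, a', Fin.mk.injEq]
    exact h j k
  let e : {c // c ∈ Set.range a} ≃ {c // c ∈ Set.range a'} :=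
    { toFun := fun c => ⟨a' c.2.choose, ⟨_, rfl⟩⟩
      invFun := fun c => ⟨a c.2.choose, ⟨_, rfl⟩⟩
      left_inv := fun c => by
        have h1 : ∃ y, a' y = a' c.2.choose := ⟨_, rfl⟩
        exact Subtype.ext (((ha _ _).2 h1.choose_spec).trans c.2.choose_spec)
      right_inv := fun c => by
        have h1 : ∃ y, a y = a c.2.choose := ⟨_, rfl⟩
        exact Subtype.ext (((ha _ _).1 h1.choose_spec).trans c.2.choose_spec) }
  refine ⟨e.extendSubtype.extendDomain Fin.equivSubtype, fun j => ?_⟩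
  have h1 : e.extendSubtype (a j) = a' j := by
    rw [Equiv.extendSubtype_apply_of_mem e (a j) ⟨j, rfl⟩]
    have h2 : ∃ y, a y = a j := ⟨j, rfl⟩
    exact (ha _ _).1 h2.choose_spec
  have h3 := Equiv.Perm.extendDomain_apply_image e.extendSubtype Fin.equivSubtype (a j)
  rw [h1] at h3
  exact h3

theorem mem_span_pSeries (f : NCPowerSeries) (hf : f ∈ NCSym) :
    f ∈ Submodule.span ℚ (Set.range fun a : AnySetPartition => pSeries a.2) := by
  classical
  obtain ⟨⟨N, hN⟩, hρ⟩ := hf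
  have h : f = ∑ n ∈ range (N + 1), ∑ π : SetPartition n,
      f (List.ofFn (word π)) • mSeries π := by
    refine ext' fun w => ?_
    simp only [sum_coeff, smul_coeff]
    obtain ⟨n, i, rfl⟩ : ∃ (n : ℕ) (i : Fin n → ℕ), w = List.ofFn i :=
      ⟨_, _, (List.ofFn_get w).symm⟩
    by_cases hw : n ≤ N
    · rw [Finset.sum_eq_single n]
      · obtain ⟨τ, hτ⟩ := exists_kernel i
        rw [Finset.sum_eq_single τ]
        · obtain ⟨ρ, hρ'⟩ := exists_perm (word τ) i (fun j k => by rw [word_eq_iff, hτ])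
          rw [mSeries_ofFn, if_pos hτ, mul_one, ← hρ ρ (List.ofFn (word τ)), List.map_ofFn]
          congr 2
          funext j
          exact (hρ' j).symm
        · intro σ _ hσ
          rw [mSeries_ofFn, if_neg, mul_zero]
          intro h
          simp only [hτ] at h
          exact hσ (le_antisymm ((le_iff_sameBlock _ _).2 fun j k => (h j k).2)
            ((le_iff_sameBlock _ _).2 fun j k => (h j k).1))
        · simp
      · intro m _ hm
        exact Finset.sum_eq_zero fun σ _ => by
          rw [mSeries_of_length_ne σ _ (by simpa using hm.symm), mul_zero]
      · intro h
        exact absurd (mem_range.2 (by omega)) h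
    · rw [hN _ (by simpa using hw), Finset.sum_eq_zero]
      intro m hm
      rw [mem_range] at hm
      have hne : (List.ofFn i).length ≠ m := by
        rw [List.length_ofFn]
        omega
      exact Finset.sum_eq_zero fun σ _ => by
        rw [mSeries_of_length_ne σ _ hne, mul_zero]
  rw [h]
  exact Submodule.sum_mem _ fun n _ => Submodule.sum_mem _ fun π _ =>
    Submodule.smul_mem _ _ (mSeries_mem_span π)

theorem p_span : ⊤ ≤ Submodule.span ℚ (Set.range fun a : AnySetPartition => p a.2) := by
  rintro ⟨f, hf⟩ -
  have h := mem_span_pSeries f hf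
  have hr : (Set.range fun a : AnySetPartition => pSeries a.2) =
      NCSym.val.toLinearMap '' (Set.range fun a : AnySetPartition => p a.2) := by
    rw [← Set.range_comp]
    rfl
  rw [hr, Submodule.span_image] at h
  obtain ⟨g, hg, hgf⟩ := h
  have : g = ⟨f, hf⟩ := Subtype.ext hgf
  rwa [← this]

/-- The `p`-basis of `NCSym`. -/
noncomputable def pBasis : Module.Basis AnySetPartition ℚ NCSym :=
  Module.Basis.mk p_linearIndependent p_span

/-- The coproduct of `NCSym`: the linear map with
`Δ(p_π) = ∑ p_{St(π|_{S₁})} ⊗ p_{St(π|_{S₂})}` over all decompositions `[n] = S₁ ⊔ S₂`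
such that `π = π|_{S₁} ⊔ π|_{S₂}` (here `S₁ = S` and `S₂ = Sᶜ`). -/
noncomputable def coproduct : NCSym →ₗ[ℚ] NCSym ⊗[ℚ] NCSym := by
  classical
  exact pBasis.constr ℚ fun a =>
    ∑ S : Finset (Fin a.1) with Splits a.2 S, p (stRestr a.2 S).2 ⊗ₜ[ℚ] p (stRestr a.2 Sᶜ).2

end NCS

/-!
Everything is reduced to the power sums `p_π`.

*Basis.* Möbius inversion turns the definition of `x_π` into `p_π = ∑_{σ ≤ π} x_σ` (`p_eq_sum_x`),
so `p_π ↦ x_π` and `p_π ↦ ∑_{σ ≤ π} p_σ` are inverse linear maps and the `x_π` are the image of the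
`p`-basis under an automorphism (`xBasis`).

*Coproduct coefficients.* By `p_eq_sum_x` the coefficient of `x_σ` in `p_{St(ν|_S)}` is `1` or `0`
according to whether `σ ≤ St(ν|_S)`. Expanding `x_π = ∑ μ(ν, π) p_ν` and applying the definition of
the coproduct gives `repr_coproduct_x`. For the one-block partition it remains to evaluate
`μ(ν, [[n]])` (`moebius_top`): counting the `q`-colourings of `[n]` that are constant on the blocks
of `σ` gives `q ^ ℓ(σ) = ∑_{ν ≥ σ} q (q - 1) ⋯ (q - ℓ(ν) + 1)`, and comparing coefficients of `q`
shows that `(-1) ^ (ℓ(ν) - 1) (ℓ(ν) - 1)!` satisfies the recursion that determines `μ(ν, [[n]])`.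

*Products and permutations.* The power sums satisfy `p_π p_ρ = p_{π|ρ}` and `η ∘ p_π = p_{η(π)}`.
The refinements of `π|ρ` are exactly the `σ|τ` with `σ ≤ π`, `τ ≤ ρ`, and those of `η(π)` are the
`η(σ)` with `σ ≤ π`; since the `p` are the sums of the `x` over refinements, the identities pass to
the `x` by induction on the refinement order (`x_mul_x`, `permActLinear_x`).

*Bialgebra.* On the `p`-basis `Δ` is multiplicative because a subset of `[n + m]` is `A ∪ (n + B)`
for unique `A ⊆ [n]`, `B ⊆ [m]`, it splits `π|ρ` iff `A` splits `π` and `B` splits `ρ`, and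
restriction and standardization commute with the slash product (`stRestr_slash`).
-/

namespace NCS

/-! ### Set partitions as equivalence relations -/

theorem SameBlock.symm {n : ℕ} {π : SetPartition n} {j k : Fin n} (h : SameBlock π j k) :
    SameBlock π k j :=
  (sameBlock_iff π k j).2 ((sameBlock_iff π j k).1 h).symm

theorem eq_of_sameBlock {n : ℕ} {σ π : SetPartition n}
    (h : ∀ j k, SameBlock σ j k ↔ SameBlock π j k) : σ = π :=
  le_antisymm ((le_iff_sameBlock _ _).2 fun j k => (h j k).1)
    ((le_iff_sameBlock _ _).2 fun j k => (h j k).2)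

/-- Every map on `[n]` is constant exactly on the blocks of some set partition. -/
theorem exists_sameBlock_iff {n : ℕ} {α : Type*} (f : Fin n → α) :
    ∃ π : SetPartition n, ∀ j k, SameBlock π j k ↔ f j = f k := by
  classical
  refine ⟨Finpartition.ofSetoid (Setoid.ker f), fun j k => ?_⟩
  rw [sameBlock_iff, ← Finpartition.mem_part_iff_part_eq_part _ (mem_univ j) (mem_univ k),
    Finpartition.mem_part_ofSetoid_iff_rel, Setoid.ker_def]
  exact eq_comm

theorem exists_mem_restr_iff {n : ℕ} (π : SetPartition n) (S : Finset (Fin n)) (j k : Fin n) :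
    (∃ B ∈ (restr π S).parts, j ∈ B ∧ k ∈ B) ↔ j ∈ S ∧ k ∈ S ∧ SameBlock π j k := by
  simp only [restr, Finpartition.restrict, mem_erase, mem_image, SameBlock, inf_eq_inter,
    bot_eq_empty]
  constructor
  · rintro ⟨B, ⟨-, C, hC, rfl⟩, hj, hk⟩
    simp only [mem_inter] at hj hk
    exact ⟨hj.2, hk.2, C, hC, hj.1, hk.1⟩
  · rintro ⟨hj, hk, C, hC, hjC, hkC⟩
    have hj' : j ∈ C ∩ S := mem_inter.2 ⟨hjC, hj⟩
    exact ⟨C ∩ S, ⟨ne_empty_of_mem hj', C, hC, rfl⟩, hj', mem_inter.2 ⟨hkC, hk⟩⟩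

theorem sameBlock_standardize {n k : ℕ} (π : SetPartition n) {S : Finset (Fin n)}
    (h : S.card = k) (i j : Fin k) :
    SameBlock (standardize h (restr π S)) i j ↔
      SameBlock π (S.orderEmbOfFin h i) (S.orderEmbOfFin h j) := by
  have h1 := exists_mem_restr_iff π S (S.orderEmbOfFin h i) (S.orderEmbOfFin h j)
  simp only [S.orderEmbOfFin_mem h, true_and] at h1
  rw [← h1]
  simp [SameBlock, standardize, Finpartition.ofExistsUnique]

/-- `S` splits `π` iff `S` is a union of blocks of `π`. -/
theorem splits_iff {n : ℕ} (π : SetPartition n) (S : Finset (Fin n)) :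
    Splits π S ↔ ∀ j k, SameBlock π j k → (j ∈ S ↔ k ∈ S) := by
  constructor
  · rintro h j k ⟨B, hB, hj, hk⟩
    rw [Splits] at h
    rw [h] at hB
    rcases mem_union.1 hB with hB | hB
    · have := (exists_mem_restr_iff π S j k).1 ⟨B, hB, hj, hk⟩
      tauto
    · have := (exists_mem_restr_iff π Sᶜ j k).1 ⟨B, hB, hj, hk⟩
      simp only [mem_compl] at this
      tauto
  · intro h
    have hsub : ∀ (B : Finset (Fin n)), B ∈ π.parts → B ⊆ S ∨ B ⊆ Sᶜ := by
      intro B hB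
      obtain ⟨b, hb⟩ := π.nonempty_of_mem_parts hB
      by_cases hbS : b ∈ S
      · exact Or.inl fun c hc => (h b c ⟨B, hB, hb, hc⟩).1 hbS
      · exact Or.inr fun c hc => mem_compl.2 fun hcS => hbS ((h b c ⟨B, hB, hb, hc⟩).2 hcS)
    ext B
    simp only [restr, Finpartition.restrict, mem_erase, mem_image, mem_union, inf_eq_inter,
      bot_eq_empty]
    constructor
    · intro hB
      have hne := (π.nonempty_of_mem_parts hB).ne_empty
      rcases hsub B hB with hS | hS
      · exact Or.inl ⟨hne, B, hB, inter_eq_left.2 hS⟩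
      · exact Or.inr ⟨hne, B, hB, inter_eq_left.2 hS⟩
    · -- a nonempty trace of a block on `S` or `Sᶜ` is the whole block
      rintro (⟨hne, C, hC, rfl⟩ | ⟨hne, C, hC, rfl⟩)
      · rcases hsub C hC with hS | hS
        · rwa [inter_eq_left.2 hS]
        · exact absurd (disjoint_iff_inter_eq_empty.1 (subset_compl_iff_disjoint_right.1 hS)) hne
      · rcases hsub C hC with hS | hS
        · exact absurd (disjoint_iff_inter_eq_empty.1
            (disjoint_compl_right.mono_left hS)) hne
        · rwa [inter_eq_left.2 hS]

theorem stRestr_eq {n k : ℕ} (π : SetPartition n) {S : Finset (Fin n)} (h : S.card = k) :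
    stRestr π S = ⟨k, standardize h (restr π S)⟩ := by
  subst h
  rfl

/-- `LeStRestr` in terms of the bundled partition `stRestr`. -/
theorem leStRestr_iff {n k : ℕ} (σ : SetPartition k) (π : SetPartition n) (S : Finset (Fin n)) :
    LeStRestr σ π S ↔ ∃ h : (stRestr π S).1 = k, σ ≤ h ▸ (stRestr π S).2 := by
  constructor
  · rintro ⟨rfl, h⟩
    exact ⟨rfl, h⟩
  · rintro ⟨h, h'⟩
    obtain rfl : S.card = k := h
    exact ⟨rfl, h'⟩

/-! ### The slash product of set partitions -/

section Slash

variable {n m : ℕ} (π : SetPartition n) (ρ : SetPartition m)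

theorem sameBlock_slash (a b : Fin (n + m)) :
    SameBlock (slash π ρ) a b ↔
      (∃ i j, a = Fin.castAdd m i ∧ b = Fin.castAdd m j ∧ SameBlock π i j) ∨
        (∃ i j, a = Fin.natAdd n i ∧ b = Fin.natAdd n j ∧ SameBlock ρ i j) := by
  simp only [SameBlock, slash, Finpartition.ofExistsUnique, mem_union, mem_image]
  constructor
  · rintro ⟨B, ⟨C, hC, rfl⟩ | ⟨C, hC, rfl⟩, ha, hb⟩
    · obtain ⟨i, hi, rfl⟩ := mem_map.1 ha
      obtain ⟨j, hj, rfl⟩ := mem_map.1 hb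
      exact Or.inl ⟨i, j, rfl, rfl, C, hC, hi, hj⟩
    · obtain ⟨i, hi, rfl⟩ := mem_map.1 ha
      obtain ⟨j, hj, rfl⟩ := mem_map.1 hb
      exact Or.inr ⟨i, j, rfl, rfl, C, hC, hi, hj⟩
  · rintro (⟨i, j, rfl, rfl, C, hC, hi, hj⟩ | ⟨i, j, rfl, rfl, C, hC, hi, hj⟩)
    · exact ⟨_, Or.inl ⟨C, hC, rfl⟩, mem_map.2 ⟨i, hi, rfl⟩, mem_map.2 ⟨j, hj, rfl⟩⟩
    · exact ⟨_, Or.inr ⟨C, hC, rfl⟩, mem_map.2 ⟨i, hi, rfl⟩, mem_map.2 ⟨j, hj, rfl⟩⟩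

theorem castAdd_ne_natAdd (i : Fin n) (j : Fin m) : Fin.castAdd m i ≠ Fin.natAdd n j := by
  intro h
  have := congrArg Fin.val h
  simp only [Fin.val_castAdd, Fin.val_natAdd] at this
  omega

@[simp]
theorem sameBlock_slash_castAdd (i j : Fin n) :
    SameBlock (slash π ρ) (Fin.castAdd m i) (Fin.castAdd m j) ↔ SameBlock π i j := by
  rw [sameBlock_slash]
  constructor
  · rintro (⟨i', j', hi, hj, h⟩ | ⟨i', j', hi, hj, h⟩)
    · rwa [Fin.castAdd_injective _ _ hi, Fin.castAdd_injective _ _ hj]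
    · exact absurd hi (castAdd_ne_natAdd _ _)
  · exact fun h => Or.inl ⟨i, j, rfl, rfl, h⟩

@[simp]
theorem sameBlock_slash_natAdd (i j : Fin m) :
    SameBlock (slash π ρ) (Fin.natAdd n i) (Fin.natAdd n j) ↔ SameBlock ρ i j := by
  rw [sameBlock_slash]
  constructor
  · rintro (⟨i', j', hi, hj, h⟩ | ⟨i', j', hi, hj, h⟩)
    · exact absurd hi.symm (castAdd_ne_natAdd _ _)
    · rwa [Fin.natAdd_injective _ _ hi, Fin.natAdd_injective _ _ hj]
  · exact fun h => Or.inr ⟨i, j, rfl, rfl, h⟩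

@[simp]
theorem not_sameBlock_slash_castAdd_natAdd (i : Fin n) (j : Fin m) :
    ¬ SameBlock (slash π ρ) (Fin.castAdd m i) (Fin.natAdd n j) := by
  rw [sameBlock_slash]
  rintro (⟨i', j', hi, hj, h⟩ | ⟨i', j', hi, hj, h⟩)
  · exact castAdd_ne_natAdd _ _ hj.symm
  · exact castAdd_ne_natAdd _ _ hi

@[simp]
theorem not_sameBlock_slash_natAdd_castAdd (i : Fin m) (j : Fin n) :
    ¬ SameBlock (slash π ρ) (Fin.natAdd n i) (Fin.castAdd m j) :=
  fun h => not_sameBlock_slash_castAdd_natAdd π ρ j i h.symm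

variable {π ρ}

theorem slash_le_slash_iff {σ : SetPartition n} {τ : SetPartition m} :
    slash σ τ ≤ slash π ρ ↔ σ ≤ π ∧ τ ≤ ρ := by
  simp [le_iff_sameBlock, Fin.forall_fin_add]

theorem slash_injective : Function.Injective
    fun t : SetPartition n × SetPartition m => slash t.1 t.2 := by
  rintro ⟨σ, τ⟩ ⟨σ', τ'⟩ h
  have h1 := slash_le_slash_iff.1 (le_of_eq h)
  have h2 := slash_le_slash_iff.1 (ge_of_eq h)
  exact Prod.ext (le_antisymm h1.1 h2.1) (le_antisymm h1.2 h2.2)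

/-- A refinement of `π|ρ` has no block meeting both `[n]` and its complement, hence is itself a
slash product. -/
theorem exists_slash_of_le {κ : SetPartition (n + m)} (h : κ ≤ slash π ρ) :
    ∃ (σ : SetPartition n) (τ : SetPartition m), κ = slash σ τ := by
  rw [le_iff_sameBlock] at h
  obtain ⟨σ, hσ⟩ := exists_sameBlock_iff fun i : Fin n => κ.part (Fin.castAdd m i)
  obtain ⟨τ, hτ⟩ := exists_sameBlock_iff fun i : Fin m => κ.part (Fin.natAdd n i)
  simp only [← sameBlock_iff] at hσ hτ
  refine ⟨σ, τ, eq_of_sameBlock fun a b => ?_⟩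
  refine Fin.addCases (fun i => ?_) (fun i => ?_) a <;>
    refine Fin.addCases (fun j => ?_) (fun j => ?_) b
  · simp [hσ]
  · simpa using fun h' => not_sameBlock_slash_castAdd_natAdd π ρ i j (h _ _ h')
  · simpa using fun h' => not_sameBlock_slash_natAdd_castAdd π ρ i j (h _ _ h')
  · simp [hτ]

end Slash

/-! ### The action of permutations on set partitions -/

theorem sameBlock_permute {n : ℕ} (η : Equiv.Perm (Fin n)) (π : SetPartition n) (j k : Fin n) :
    SameBlock (permute η π) (η j) (η k) ↔ SameBlock π j k := by
  constructor
  · rintro ⟨B, hB, hj, hk⟩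
    obtain ⟨C, hC, rfl⟩ := mem_image.1 hB
    exact ⟨C, hC, (mem_map' η.toEmbedding).1 hj, (mem_map' η.toEmbedding).1 hk⟩
  · rintro ⟨C, hC, hj, hk⟩
    exact ⟨C.map η.toEmbedding, mem_image_of_mem _ hC, mem_map_of_mem _ hj, mem_map_of_mem _ hk⟩

theorem permute_le_permute_iff {n : ℕ} (η : Equiv.Perm (Fin n)) {σ π : SetPartition n} :
    permute η σ ≤ permute η π ↔ σ ≤ π := by
  rw [le_iff_sameBlock, le_iff_sameBlock, η.surjective.forall₂]
  simp only [sameBlock_permute]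

theorem permute_surjective {n : ℕ} (η : Equiv.Perm (Fin n)) :
    Function.Surjective (permute η) := by
  intro π
  refine ⟨permute η.symm π, eq_of_sameBlock fun j k => ?_⟩
  have h := sameBlock_permute η (permute η.symm π) (η.symm j) (η.symm k)
  rw [η.apply_symm_apply, η.apply_symm_apply] at h
  rw [h, sameBlock_permute]

theorem permute_injective {n : ℕ} (η : Equiv.Perm (Fin n)) :
    Function.Injective (permute η) := fun _ _ h =>
  le_antisymm ((permute_le_permute_iff η).1 (le_of_eq h))
    ((permute_le_permute_iff η).1 (ge_of_eq h))

/-! ### Möbius inversion and the `x`-basis -/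

section Inversion

open Classical in
theorem sum_moebius_right {n : ℕ} (σ π : SetPartition n) :
    ∑ ν : SetPartition n with σ ≤ ν ∧ ν ≤ π, moebius σ ν = if σ = π then 1 else 0 := by
  have h : univ.filter (fun ν : SetPartition n => σ ≤ ν ∧ ν ≤ π) = Icc σ π := by
    ext ν
    simp
  rw [h]
  exact (IncidenceAlgebra.sum_Icc_mu_right σ π).trans (if_congr Iff.rfl rfl rfl)

open Classical in
theorem sum_moebius_left {n : ℕ} (σ π : SetPartition n) :
    ∑ ν : SetPartition n with σ ≤ ν ∧ ν ≤ π, moebius ν π = if σ = π then 1 else 0 := by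
  have h : univ.filter (fun ν : SetPartition n => σ ≤ ν ∧ ν ≤ π) = Icc σ π := by
    ext ν
    simp
  rw [h]
  exact (IncidenceAlgebra.sum_Icc_mu_left σ π).trans (if_congr Iff.rfl rfl rfl)

variable {n : ℕ} {M : Type*} [AddCommGroup M] [Module ℚ M]

open Classical in
theorem sum_sum_moebius_smul (f : SetPartition n → M) (π : SetPartition n) :
    ∑ σ : SetPartition n with σ ≤ π, ∑ τ : SetPartition n with τ ≤ σ, moebius τ σ • f τ =
      f π := by
  rw [Finset.sum_comm' (t' := univ) (s' := fun τ => univ.filter fun σ => τ ≤ σ ∧ σ ≤ π)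
    (by simp [and_comm])]
  simp only [← Finset.sum_smul, sum_moebius_right]
  simp

open Classical in
theorem sum_moebius_smul_sum (f : SetPartition n → M) (π : SetPartition n) :
    ∑ σ : SetPartition n with σ ≤ π, moebius σ π • ∑ τ : SetPartition n with τ ≤ σ, f τ =
      f π := by
  simp only [Finset.smul_sum]
  rw [Finset.sum_comm' (t' := univ) (s' := fun τ => univ.filter fun σ => τ ≤ σ ∧ σ ≤ π)
    (by simp [and_comm])]
  simp only [← Finset.sum_smul, sum_moebius_left]
  simp

end Inversion

open Classical in
theorem x_eq_sum {n : ℕ} (π : SetPartition n) :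
    x π = ∑ σ : SetPartition n with σ ≤ π, moebius σ π • p σ := by
  unfold x
  congr

open Classical in
theorem p_eq_sum_x {n : ℕ} (π : SetPartition n) :
    p π = ∑ σ : SetPartition n with σ ≤ π, x σ := by
  simp only [x_eq_sum]
  exact (sum_sum_moebius_smul _ π).symm

theorem pBasis_apply (a : AnySetPartition) : pBasis a = p a.2 :=
  Module.Basis.mk_apply _ _ a

/-- The linear map `p_π ↦ x_π`. -/
noncomputable def pToX : NCSym →ₗ[ℚ] NCSym := pBasis.constr ℚ fun a => x a.2

open Classical in
/-- The linear map `p_π ↦ ∑_{σ ≤ π} p_σ`, the inverse of `pToX`. -/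
noncomputable def pToSum : NCSym →ₗ[ℚ] NCSym :=
  pBasis.constr ℚ fun a => ∑ σ : SetPartition a.1 with σ ≤ a.2, p σ

theorem pToX_p {n : ℕ} (π : SetPartition n) : pToX (p π) = x π := by
  have h := pBasis.constr_basis ℚ (fun a : AnySetPartition => x a.2) ⟨n, π⟩
  rwa [pBasis_apply] at h

open Classical in
theorem pToSum_p {n : ℕ} (π : SetPartition n) :
    pToSum (p π) = ∑ σ : SetPartition n with σ ≤ π, p σ := by
  have h := pBasis.constr_basis ℚ
    (fun a : AnySetPartition => ∑ σ : SetPartition a.1 with σ ≤ a.2, p σ) ⟨n, π⟩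
  rwa [pBasis_apply] at h

/-- The basis `x_π` of `NCSym`. -/
noncomputable def xBasis : Module.Basis AnySetPartition ℚ NCSym :=
  pBasis.map <| LinearEquiv.ofLinearMap pToX pToSum
    (pBasis.ext fun ⟨n, π⟩ => by
      classical
      simp only [pBasis_apply, LinearMap.comp_apply, pToSum_p, map_sum, pToX_p, ← p_eq_sum_x,
        LinearMap.id_apply])
    (pBasis.ext fun ⟨n, π⟩ => by
      classical
      simp only [pBasis_apply, LinearMap.comp_apply, pToX_p, x_eq_sum, map_sum, map_smul, pToSum_p,
        sum_moebius_smul_sum, LinearMap.id_apply])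

theorem xBasis_apply {n : ℕ} (π : SetPartition n) : xBasis ⟨n, π⟩ = x π := by
  rw [xBasis, Module.Basis.map_apply, pBasis_apply]
  exact pToX_p π

/-! ### The coefficients of the coproduct -/

open Classical in
theorem xBasis_repr_p {n k : ℕ} (π : SetPartition n) (σ : SetPartition k) :
    xBasis.repr (p π) ⟨k, σ⟩ = if ∃ h : n = k, σ ≤ h ▸ π then 1 else 0 := by
  rw [p_eq_sum_x]
  simp only [← xBasis_apply, map_sum, Module.Basis.repr_self, Finsupp.finsetSum_apply,
    Finsupp.single_apply]
  by_cases h : n = k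
  · subst h
    simp
  · rw [if_neg (fun h' => h h'.1)]
    exact Finset.sum_eq_zero fun τ _ => if_neg fun h' => h (congrArg Sigma.fst h')

open Classical in
theorem xBasis_repr_p_stRestr {n k : ℕ} (π : SetPartition n) (S : Finset (Fin n))
    (σ : SetPartition k) :
    xBasis.repr (p (stRestr π S).2) ⟨k, σ⟩ = if LeStRestr σ π S then 1 else 0 := by
  rw [xBasis_repr_p]
  exact if_congr (leStRestr_iff σ π S).symm rfl rfl

open Classical in
theorem coproduct_p {n : ℕ} (π : SetPartition n) :
    coproduct (p π) = ∑ S : Finset (Fin n) with Splits π S,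
      p (stRestr π S).2 ⊗ₜ[ℚ] p (stRestr π Sᶜ).2 := by
  have h := pBasis.constr_basis ℚ (fun a : AnySetPartition =>
    ∑ S : Finset (Fin a.1) with Splits a.2 S, p (stRestr a.2 S).2 ⊗ₜ[ℚ] p (stRestr a.2 Sᶜ).2)
    ⟨n, π⟩
  rw [pBasis_apply] at h
  exact h

open Classical in
theorem repr_coproduct_x {n k l : ℕ} (π : SetPartition n) (σ : SetPartition k)
    (τ : SetPartition l) :
    (xBasis.tensorProduct xBasis).repr (coproduct (x π)) (⟨k, σ⟩, ⟨l, τ⟩) =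
      ∑ t : SetPartition n × Finset (Fin n) with
        t.1 ≤ π ∧ Splits t.1 t.2 ∧ LeStRestr σ t.1 t.2 ∧ LeStRestr τ t.1 t.2ᶜ,
          moebius t.1 π := by
  rw [x_eq_sum]
  simp only [map_sum, map_smul, coproduct_p, Finsupp.finsetSum_apply, Finsupp.smul_apply,
    Module.Basis.tensorProduct_repr_tmul_apply, xBasis_repr_p_stRestr, smul_eq_mul]
  rw [Finset.sum_filter, Finset.sum_filter, Fintype.sum_prod_type]
  refine Finset.sum_congr rfl fun ν _ => ?_
  by_cases hν : ν ≤ π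
  · rw [if_pos hν, Finset.sum_filter, Finset.mul_sum]
    refine Finset.sum_congr rfl fun S _ => ?_
    split_ifs <;> simp_all
  · simp [hν]

/-! ### Products and permutations of the `x_π` -/

/-- `p` is multiplicative for the slash product. -/
theorem p_mul_p {n m : ℕ} (π : SetPartition n) (ρ : SetPartition m) :
    p π * p ρ = p (slash π ρ) := by
  classical
  refine Subtype.ext (NCPowerSeries.ext' fun w => ?_)
  change (pSeries π * pSeries ρ) w = pSeries (slash π ρ) w
  rw [NCPowerSeries.mul_coeff]
  by_cases hw : w.length = n + m
  · obtain ⟨i, rfl⟩ := exists_ofFn w hw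
    rw [Finset.sum_eq_single n]
    · have h1 : (List.ofFn i).take n = List.ofFn fun j => i (Fin.castAdd m j) := by
        rw [List.ofFn_add, List.take_left' (by simp)]
        rfl
      have h2 : (List.ofFn i).drop n = List.ofFn fun j => i (Fin.natAdd n j) := by
        rw [List.ofFn_add, List.drop_left' (by simp)]
      rw [h1, h2, pSeries_ofFn, pSeries_ofFn, pSeries_ofFn, ite_zero_mul_ite_zero, mul_one]
      exact if_congr (by simp [Fin.forall_fin_add]) rfl rfl
    · intro k hk hkn
      rw [mem_range, hw] at hk
      rw [pSeries_of_length_ne π _ (by rw [List.length_take, hw]; omega), zero_mul]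
    · intro h
      rw [mem_range, hw] at h
      omega
  · rw [pSeries_of_length_ne _ w hw]
    refine Finset.sum_eq_zero fun k hk => ?_
    rw [mem_range] at hk
    by_cases hkn : k = n
    · rw [pSeries_of_length_ne ρ _ (by rw [List.length_drop]; omega), mul_zero]
    · rw [pSeries_of_length_ne π _ (by rw [List.length_take]; omega), zero_mul]

/-- Both sides have the same sums over the refinements of `(π, ρ)`, since the refinements of `π|ρ`
are the `σ|τ` with `σ ≤ π` and `τ ≤ ρ`; so they agree by induction on `(π, ρ)`. -/
theorem x_mul_x {n m : ℕ} (π : SetPartition n) (ρ : SetPartition m) :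
    x π * x ρ = x (slash π ρ) := by
  classical
  suffices H : ∀ t : SetPartition n × SetPartition m, x t.1 * x t.2 = x (slash t.1 t.2) from
    H (π, ρ)
  intro t
  induction t using WellFoundedLT.induction with
  | _ t ih =>
    have h := p_mul_p t.1 t.2
    simp only [p_eq_sum_x, Finset.sum_mul_sum] at h
    rw [← Finset.sum_product'] at h
    have himg : (univ.filter fun κ => κ ≤ slash t.1 t.2) =
        ((univ.filter fun σ => σ ≤ t.1) ×ˢ (univ.filter fun τ => τ ≤ t.2)).image
          fun s => slash s.1 s.2 := by
      ext κ
      simp only [mem_filter, mem_univ, true_and, mem_image, mem_product]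
      constructor
      · intro hκ
        obtain ⟨σ, τ, rfl⟩ := exists_slash_of_le hκ
        exact ⟨(σ, τ), slash_le_slash_iff.1 hκ, rfl⟩
      · rintro ⟨s, hs, rfl⟩
        exact slash_le_slash_iff.2 hs
    rw [himg, Finset.sum_image slash_injective.injOn] at h
    have ht : t ∈ (univ.filter fun σ => σ ≤ t.1) ×ˢ (univ.filter fun τ => τ ≤ t.2) := by simp
    rw [← Finset.add_sum_erase _ _ ht, ← Finset.add_sum_erase _ _ ht] at h
    -- all terms of the two sums but the top one agree by induction and cancel
    rw [Finset.sum_congr rfl fun s hs => ih s ?_] at h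
    · exact add_right_cancel h
    · simp only [mem_erase, mem_product, mem_filter, mem_univ, true_and] at hs
      exact lt_of_le_of_ne hs.2 hs.1

theorem coe_sum {ι : Type*} (s : Finset ι) (f : ι → NCSym) :
    ((∑ i ∈ s, f i : NCSym) : NCPowerSeries) = ∑ i ∈ s, (f i : NCPowerSeries) :=
  map_sum NCSym.val f s

/-- `η ∘ ·` as a linear map. -/
noncomputable def permActLinear {n : ℕ} (η : Equiv.Perm (Fin n)) :
    NCPowerSeries →ₗ[ℚ] NCPowerSeries where
  toFun := NCPowerSeries.permAct η
  map_add' f g := by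
    refine NCPowerSeries.ext' fun w => ?_
    simp only [NCPowerSeries.permAct, NCPowerSeries.add_coeff]
    split_ifs <;> rfl
  map_smul' c f := by
    refine NCPowerSeries.ext' fun w => ?_
    simp only [NCPowerSeries.permAct, NCPowerSeries.smul_coeff, RingHom.id_apply]
    split_ifs <;> rfl

theorem permActLinear_p {n : ℕ} (η : Equiv.Perm (Fin n)) (π : SetPartition n) :
    permActLinear η (p π : NCPowerSeries) = p (permute η π) := by
  classical
  refine NCPowerSeries.ext' fun w => ?_
  change NCPowerSeries.permAct η (pSeries π) w = pSeries (permute η π) w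
  rw [NCPowerSeries.permAct]
  by_cases hw : w.length = n
  · obtain ⟨i, rfl⟩ := exists_ofFn w hw
    rw [dif_pos hw]
    have h : (fun j : Fin n => (List.ofFn i).get ((η j).cast hw.symm)) = fun j => i (η j) := by
      funext j
      simp
    rw [h, pSeries_ofFn, pSeries_ofFn]
    refine if_congr ?_ rfl rfl
    refine Iff.trans ?_ η.surjective.forall₂.symm
    simp only [sameBlock_permute]
  · rw [dif_neg hw, pSeries_of_length_ne _ _ hw, pSeries_of_length_ne _ _ hw]

/-- As for `x_mul_x`: `σ ↦ η(σ)` is a bijection between the refinements of `π` and of `η(π)`. -/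
theorem permActLinear_x {n : ℕ} (η : Equiv.Perm (Fin n)) (π : SetPartition n) :
    permActLinear η (x π : NCPowerSeries) = x (permute η π) := by
  classical
  induction π using WellFoundedLT.induction with
  | _ π ih =>
    have h := permActLinear_p η π
    have himg : (univ.filter fun κ => κ ≤ permute η π) =
        (univ.filter fun σ => σ ≤ π).image (permute η) := by
      ext κ
      obtain ⟨σ, rfl⟩ := permute_surjective η κ
      simp [permute_le_permute_iff, (permute_injective η).eq_iff]
    rw [p_eq_sum_x, p_eq_sum_x, himg, Finset.sum_image (permute_injective η).injOn] at h
    have hπ : π ∈ univ.filter fun σ => σ ≤ π := by simp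
    rw [coe_sum, coe_sum, map_sum] at h
    rw [← Finset.add_sum_erase _ _ hπ, ← Finset.add_sum_erase _ _ hπ] at h
    -- all terms of the two sums but the top one agree by induction and cancel
    rw [Finset.sum_congr rfl fun s hs => ih s ?_] at h
    · exact add_right_cancel h
    · simp only [mem_erase, mem_filter, mem_univ, true_and] at hs
      exact lt_of_le_of_ne hs.2 hs.1

/-! ### Multiplicativity of the coproduct -/

section Multiplicativity

variable {n m : ℕ}

/-- The subset `A ∪ (n + B)` of `[n + m]`, for `A ⊆ [n]` and `B ⊆ [m]`. -/
def shiftUnion (A : Finset (Fin n)) (B : Finset (Fin m)) : Finset (Fin (n + m)) :=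
  A.map (Fin.castAddEmb m) ∪ B.map (Fin.natAddEmb n)

@[simp]
theorem castAdd_mem_shiftUnion {A : Finset (Fin n)} {B : Finset (Fin m)} {i : Fin n} :
    Fin.castAdd m i ∈ shiftUnion A B ↔ i ∈ A := by
  simp [shiftUnion, (castAdd_ne_natAdd _ _).symm]

@[simp]
theorem natAdd_mem_shiftUnion {A : Finset (Fin n)} {B : Finset (Fin m)} {i : Fin m} :
    Fin.natAdd n i ∈ shiftUnion A B ↔ i ∈ B := by
  simp [shiftUnion, castAdd_ne_natAdd]

theorem card_shiftUnion (A : Finset (Fin n)) (B : Finset (Fin m)) :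
    (shiftUnion A B).card = A.card + B.card := by
  rw [shiftUnion, card_union_of_disjoint, card_map, card_map]
  rw [disjoint_left]
  rintro a ha hb
  obtain ⟨i, -, rfl⟩ := mem_map.1 ha
  obtain ⟨j, -, hj⟩ := mem_map.1 hb
  exact castAdd_ne_natAdd i j hj.symm

theorem compl_shiftUnion (A : Finset (Fin n)) (B : Finset (Fin m)) :
    (shiftUnion A B)ᶜ = shiftUnion Aᶜ Bᶜ := by
  ext a
  refine Fin.addCases (fun i => ?_) (fun i => ?_) a <;> simp

/-- Subsets of `[n + m]` correspond to pairs of subsets of `[n]` and `[m]`. -/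
def shiftUnionEquiv : Finset (Fin n) × Finset (Fin m) ≃ Finset (Fin (n + m)) where
  toFun t := shiftUnion t.1 t.2
  invFun S := (univ.filter fun i => Fin.castAdd m i ∈ S, univ.filter fun i => Fin.natAdd n i ∈ S)
  left_inv t := by ext <;> simp
  right_inv S := by
    ext a
    refine Fin.addCases (fun i => ?_) (fun i => ?_) a <;> simp

theorem splits_slash_iff (π : SetPartition n) (ρ : SetPartition m) (A : Finset (Fin n))
    (B : Finset (Fin m)) :
    Splits (slash π ρ) (shiftUnion A B) ↔ Splits π A ∧ Splits ρ B := by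
  simp [splits_iff, Fin.forall_fin_add]

/-- The order preserving bijection onto `A ∪ (n + B)` is that onto `A` followed by that onto `B`. -/
theorem orderEmbOfFin_shiftUnion (A : Finset (Fin n)) (B : Finset (Fin m)) :
    ⇑((shiftUnion A B).orderEmbOfFin (card_shiftUnion A B)) =
      Fin.addCases (fun i => Fin.castAdd m (A.orderEmbOfFin rfl i))
        (fun i => Fin.natAdd n (B.orderEmbOfFin rfl i)) := by
  refine (orderEmbOfFin_unique _ (fun a => ?_) ?_).symm
  · refine Fin.addCases (fun i => ?_) (fun i => ?_) a <;> simp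
  · intro a b
    refine Fin.addCases (fun i => ?_) (fun i => ?_) a <;>
      refine Fin.addCases (fun j => ?_) (fun j => ?_) b <;> intro h
    · have h' : i < j := h
      simp only [Fin.addCases_left]
      exact (A.orderEmbOfFin rfl).strictMono h'
    · simp only [Fin.addCases_left, Fin.addCases_right, Fin.lt_def, Fin.val_castAdd,
        Fin.val_natAdd]
      omega
    · simp only [Fin.lt_def, Fin.val_castAdd, Fin.val_natAdd] at h
      omega
    · have h' : i < j := by simpa using h
      simpa using h'

/-- Restriction and standardization commute with the slash product. -/
theorem stRestr_slash (π : SetPartition n) (ρ : SetPartition m) (A : Finset (Fin n))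
    (B : Finset (Fin m)) :
    stRestr (slash π ρ) (shiftUnion A B) =
      ⟨A.card + B.card, slash (stRestr π A).2 (stRestr ρ B).2⟩ := by
  rw [stRestr_eq _ (card_shiftUnion A B)]
  congr 1
  refine eq_of_sameBlock fun a b => ?_
  rw [sameBlock_standardize, orderEmbOfFin_shiftUnion]
  refine Fin.addCases (fun i => ?_) (fun i => ?_) a <;>
    refine Fin.addCases (fun j => ?_) (fun j => ?_) b <;>
    simp [stRestr, sameBlock_standardize]

theorem p_stRestr_slash (π : SetPartition n) (ρ : SetPartition m) (A : Finset (Fin n))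
    (B : Finset (Fin m)) :
    p (stRestr (slash π ρ) (shiftUnion A B)).2 = p (stRestr π A).2 * p (stRestr ρ B).2 := by
  rw [p_mul_p]
  exact congrArg (fun a : AnySetPartition => p a.2) (stRestr_slash π ρ A B)

theorem coproduct_p_mul_p (π : SetPartition n) (ρ : SetPartition m) :
    coproduct (p π * p ρ) = coproduct (p π) * coproduct (p ρ) := by
  classical
  rw [p_mul_p, coproduct_p, coproduct_p, coproduct_p, Finset.sum_mul_sum, ← Finset.sum_product',
    ← Finset.filter_product, univ_product_univ, Finset.sum_filter, Finset.sum_filter]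
  refine (Fintype.sum_equiv shiftUnionEquiv _ _ fun t => ?_).symm
  refine if_congr (splits_slash_iff π ρ t.1 t.2).symm ?_ rfl
  have h := p_stRestr_slash π ρ t.1ᶜ t.2ᶜ
  rw [← compl_shiftUnion] at h
  simp only [shiftUnionEquiv, Equiv.coe_fn_mk, h, p_stRestr_slash,
    Algebra.TensorProduct.tmul_mul_tmul]

end Multiplicativity

theorem coproduct_mul (f g : NCSym) : coproduct (f * g) = coproduct f * coproduct g := by
  have h : (LinearMap.mul ℚ NCSym).compr₂ coproduct =
      (LinearMap.mul ℚ (NCSym ⊗[ℚ] NCSym)).compl₁₂ coproduct coproduct := by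
    refine pBasis.ext fun a => pBasis.ext fun b => ?_
    simp only [pBasis_apply, LinearMap.compr₂_apply, LinearMap.mul_apply', LinearMap.compl₁₂_apply,
      coproduct_p_mul_p]
  exact LinearMap.congr_fun₂ h f g

/-! ### The Möbius function below the one-block partition -/

section Colourings

variable {n : ℕ}

/-- A colouring constant on the blocks of `σ` is a colouring of the blocks. -/
theorem card_colourings (σ : SetPartition n) (α : Type*) [Fintype α] [DecidableEq α]
    [DecidablePred fun f : Fin n → α => ∀ j k, SameBlock σ j k → f j = f k] :
    (univ.filter fun f : Fin n → α => ∀ j k, SameBlock σ j k → f j = f k).card =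
      Fintype.card α ^ σ.parts.card := by
  classical
  have h : Fintype.card (σ.parts → α) = Fintype.card α ^ σ.parts.card := by
    rw [Fintype.card_fun, Fintype.card_coe]
  rw [← h, ← card_univ]
  symm
  refine Finset.card_bij (fun g _ j => g ⟨σ.part j, σ.part_mem.2 (mem_univ j)⟩) ?_ ?_ ?_
  · intro g _
    simp only [mem_filter, mem_univ, true_and, sameBlock_iff]
    intro j k hjk
    congr 2
  · intro g _ g' _ hg
    funext ⟨B, hB⟩
    obtain ⟨b, hb⟩ := σ.nonempty_of_mem_parts hB
    have := congrFun hg b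
    simp only [σ.part_eq_of_mem hB hb] at this
    exact this
  · intro f hf
    simp only [mem_filter, mem_univ, true_and] at hf
    refine ⟨fun B => f (σ.nonempty_of_mem_parts B.2).choose, mem_univ _, funext fun j => ?_⟩
    refine hf _ _ ⟨σ.part j, σ.part_mem.2 (mem_univ j), ?_, σ.mem_part_self.2 (mem_univ j)⟩
    exact (σ.nonempty_of_mem_parts (σ.part_mem.2 (mem_univ j))).choose_spec

/-- A colouring whose colour classes are the blocks of `σ` is an injective colouring of the
blocks. -/
theorem card_exact_colourings (σ : SetPartition n) (α : Type*) [Fintype α] [DecidableEq α]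
    [DecidablePred fun f : Fin n → α => ∀ j k, SameBlock σ j k ↔ f j = f k] :
    (univ.filter fun f : Fin n → α => ∀ j k, SameBlock σ j k ↔ f j = f k).card =
      (Fintype.card α).descFactorial σ.parts.card := by
  classical
  have h : Fintype.card (σ.parts ↪ α) = (Fintype.card α).descFactorial σ.parts.card := by
    rw [Fintype.card_embedding_eq, Fintype.card_coe]
  rw [← h, ← card_univ]
  symm
  refine Finset.card_bij (fun g _ j => g ⟨σ.part j, σ.part_mem.2 (mem_univ j)⟩) ?_ ?_ ?_
  · intro g _
    simp [sameBlock_iff]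
  · intro g _ g' _ hg
    ext ⟨B, hB⟩
    obtain ⟨b, hb⟩ := σ.nonempty_of_mem_parts hB
    have := congrFun hg b
    simp only [σ.part_eq_of_mem hB hb] at this
    exact this
  · intro f hf
    simp only [mem_filter, mem_univ, true_and] at hf
    refine ⟨⟨fun B => f (σ.nonempty_of_mem_parts B.2).choose, fun B C hBC => ?_⟩, mem_univ _,
      funext fun j => ?_⟩
    · have h1 := (sameBlock_iff _ _ _).1 ((hf _ _).2 hBC)
      rw [σ.part_eq_of_mem B.2 (σ.nonempty_of_mem_parts B.2).choose_spec,
        σ.part_eq_of_mem C.2 (σ.nonempty_of_mem_parts C.2).choose_spec] at h1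
      exact Subtype.ext h1
    · refine (hf _ _).1 ⟨σ.part j, σ.part_mem.2 (mem_univ j), ?_, σ.mem_part_self.2 (mem_univ j)⟩
      exact (σ.nonempty_of_mem_parts (σ.part_mem.2 (mem_univ j))).choose_spec

open Classical in
/-- Counts the colourings of `[n]` by `q` colours that are constant on the blocks of `σ` according
to the partition `ν ≥ σ` into colour classes. -/
theorem pow_eq_sum_descFactorial (σ : SetPartition n) (q : ℕ) :
    q ^ σ.parts.card = ∑ ν : SetPartition n with σ ≤ ν, q.descFactorial ν.parts.card := by
  have h := card_colourings σ (Fin q)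
  rw [Fintype.card_fin] at h
  choose κ hκ using fun f : Fin n → Fin q => exists_sameBlock_iff f
  rw [← h, Finset.card_eq_sum_card_fiberwise (f := κ) (t := univ.filter fun ν => σ ≤ ν)]
  · refine Finset.sum_congr rfl fun ν hν => ?_
    have h' := card_exact_colourings ν (Fin q)
    rw [Fintype.card_fin] at h'
    rw [← h', Finset.filter_filter]
    congr 1
    ext f
    simp only [mem_filter, mem_univ, true_and] at hν ⊢
    constructor
    · rintro ⟨-, rfl⟩
      exact hκ f
    · intro hf
      refine ⟨fun j k hjk => (hf j k).1 ((le_iff_sameBlock _ _).1 hν j k hjk), ?_⟩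
      exact eq_of_sameBlock fun j k => (hκ f j k).trans (hf j k).symm
  · intro f hf
    simp only [coe_filter, mem_univ, true_and, Set.mem_ofPred_eq] at hf ⊢
    rw [le_iff_sameBlock]
    exact fun j k hjk => (hκ f j k).2 (hf j k hjk)

open Polynomial in
/-- `pow_eq_sum_descFactorial` as an identity of polynomials in `q`. -/
theorem X_pow_eq_sum_descPochhammer (σ : SetPartition n) [DecidableLE (SetPartition n)] :
    (X : ℚ[X]) ^ σ.parts.card =
      ∑ ν : SetPartition n with σ ≤ ν, descPochhammer ℚ ν.parts.card := by
  refine Polynomial.eq_of_infinite_eval_eq _ _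
    (Set.Infinite.mono ?_ (Set.infinite_range_of_injective (Nat.cast_injective (R := ℚ))))
  rintro _ ⟨q, rfl⟩
  simp only [Set.mem_ofPred_eq, eval_pow, eval_X, eval_finsetSum,
    descPochhammer_eval_eq_descFactorial]
  have h := congrArg (Nat.cast (R := ℚ)) (pow_eq_sum_descFactorial σ q)
  push_cast at h
  rw [h]
  congr

open Polynomial in
theorem descPochhammer_eval_neg_one (l : ℕ) :
    (descPochhammer ℚ l).eval (-1) = (-1) ^ l * (l.factorial : ℚ) := by
  induction l with
  | zero => simp
  | succ l ih =>
    rw [descPochhammer_succ_eval, ih, Nat.factorial_succ]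
    push_cast
    ring

open Polynomial in
theorem coeff_one_descPochhammer {l : ℕ} (hl : l ≠ 0) :
    (descPochhammer ℚ l).coeff 1 = (-1) ^ (l - 1) * ((l - 1).factorial : ℚ) := by
  obtain ⟨l, rfl⟩ := Nat.exists_eq_succ_of_ne_zero hl
  rw [Nat.succ_eq_add_one, Nat.add_sub_cancel, descPochhammer_succ_left, coeff_X_mul,
    coeff_zero_eq_eval_zero, eval_comp]
  simp [descPochhammer_eval_neg_one]

theorem card_parts_pos (hn : 1 ≤ n) (σ : SetPartition n) : σ.parts.card ≠ 0 :=
  card_ne_zero_of_mem (σ.part_mem.2 (mem_univ ⟨0, hn⟩))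

theorem card_parts_eq_one_iff (hn : 1 ≤ n) (σ : SetPartition n) : σ.parts.card = 1 ↔ σ = ⊤ := by
  constructor
  · intro h
    obtain ⟨B, hB⟩ := card_eq_one.1 h
    refine top_le_iff.1 ((le_iff_sameBlock _ _).2 fun j k _ => (sameBlock_iff _ _ _).2 ?_)
    have h1 : ∀ i, σ.part i = B := fun i => by
      have := σ.part_mem.2 (mem_univ i)
      rwa [hB, mem_singleton] at this
    rw [h1, h1]
  · rintro rfl
    obtain ⟨ι, hι⟩ := exists_sameBlock_iff fun _ : Fin n => ()
    have h1 : ∀ j k, SameBlock (⊤ : SetPartition n) j k := fun j k =>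
      (le_iff_sameBlock ι ⊤).1 le_top j k ((hι j k).2 rfl)
    refine le_antisymm (card_le_one.2 fun B hB C hC => ?_)
      (Nat.one_le_iff_ne_zero.2 (card_parts_pos hn _))
    obtain ⟨b, hb⟩ := Finpartition.nonempty_of_mem_parts _ hB
    obtain ⟨c, hc⟩ := Finpartition.nonempty_of_mem_parts _ hC
    have := (sameBlock_iff _ _ _).1 (h1 b c)
    rwa [Finpartition.part_eq_of_mem _ hB hb, Finpartition.part_eq_of_mem _ hC hc] at this

/-- `μ(ν, [[n]]) = (-1)^{ℓ(ν)-1} (ℓ(ν)-1)!`: the right hand side is the coefficient of `q` in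
`q (q-1) ⋯ (q-ℓ(ν)+1)`, so by `X_pow_eq_sum_descPochhammer` its sum over all `ν ≥ σ` is the
coefficient of `q` in `q ^ ℓ(σ)`, as required of `μ(·, [[n]])`. -/
theorem moebius_top (hn : 1 ≤ n) (ν : SetPartition n) :
    moebius ν ⊤ = (-1) ^ (ν.parts.card - 1) * ((ν.parts.card - 1).factorial : ℚ) := by
  classical
  induction ν using WellFoundedGT.induction with
  | _ ν ih =>
    have h1 := sum_moebius_left ν ⊤
    have h2 := congrArg (fun P : Polynomial ℚ => P.coeff 1) (X_pow_eq_sum_descPochhammer ν)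
    simp only [Polynomial.coeff_X_pow, Polynomial.finsetSum_coeff,
      coeff_one_descPochhammer (card_parts_pos hn _)] at h2
    rw [if_congr (eq_comm.trans (card_parts_eq_one_iff hn ν)) rfl rfl] at h2
    simp only [le_top, and_true] at h1
    -- both sides of the claim have the same sum over all `σ ≥ ν`
    have h := h1.trans h2
    have hν : ν ∈ univ.filter fun σ => ν ≤ σ := by simp
    rw [← Finset.add_sum_erase _ _ hν, ← Finset.add_sum_erase _ _ hν] at h
    rw [Finset.sum_congr rfl fun s hs => ih s ?_] at h
    · exact add_right_cancel h
    · simp only [mem_erase, mem_filter, mem_univ, true_and] at hs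
      exact lt_of_le_of_ne hs.2 (Ne.symm hs.1)

end Colourings

end NCS

open Classical in
theorem corollary3p2 :
    ∃ b : Module.Basis NCS.AnySetPartition ℚ NCS.NCSym,
      -- the `x_π` form a basis `b` of `NCSym`
      (∀ (n : ℕ) (π : NCS.SetPartition n), b ⟨n, π⟩ = NCS.x π) ∧
      -- the coefficient of `x_σ ⊗ x_τ` in `Δ(x_{[[n]]})`
      (∀ n : ℕ, 1 ≤ n → ∀ (k l : ℕ) (σ : NCS.SetPartition k) (τ : NCS.SetPartition l),
        (b.tensorProduct b).repr (NCS.coproduct (NCS.x (⊤ : NCS.SetPartition n)))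
            (⟨k, σ⟩, ⟨l, τ⟩) =
          ∑ t : NCS.SetPartition n × Finset (Fin n) with
              NCS.Splits t.1 t.2 ∧ NCS.LeStRestr σ t.1 t.2 ∧ NCS.LeStRestr τ t.1 t.2ᶜ,
            (-1 : ℚ) ^ (t.1.parts.card - 1) * ((t.1.parts.card - 1).factorial : ℚ)) ∧
      -- multiplicativity
      (∀ (n m : ℕ) (π : NCS.SetPartition n) (ρ : NCS.SetPartition m),
        NCS.x π * NCS.x ρ = NCS.x (NCS.slash π ρ)) ∧
      (∀ f g : NCS.NCSym, NCS.coproduct (f * g) = NCS.coproduct f * NCS.coproduct g) ∧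
      -- the action of the symmetric groups
      (∀ (n : ℕ) (η : Equiv.Perm (Fin n)) (π : NCS.SetPartition n),
        NCS.NCPowerSeries.permAct η (NCS.x π : NCS.NCPowerSeries) =
          (NCS.x (NCS.permute η π) : NCS.NCPowerSeries)) ∧
      -- the coefficient of `x_σ ⊗ x_τ` in `Δ(x_π)` for every set partition `π`
      (∀ (n : ℕ) (π : NCS.SetPartition n) (k l : ℕ) (σ : NCS.SetPartition k)
          (τ : NCS.SetPartition l),
        (b.tensorProduct b).repr (NCS.coproduct (NCS.x π)) (⟨k, σ⟩, ⟨l, τ⟩) =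
          ∑ t : NCS.SetPartition n × Finset (Fin n) with
              t.1 ≤ π ∧ NCS.Splits t.1 t.2 ∧ NCS.LeStRestr σ t.1 t.2 ∧
                NCS.LeStRestr τ t.1 t.2ᶜ,
            NCS.moebius t.1 π) := by
  refine ⟨NCS.xBasis, fun n π => NCS.xBasis_apply π, fun n hn k l σ τ => ?_,
    fun n m π ρ => NCS.x_mul_x π ρ, NCS.coproduct_mul,
    fun n η π => NCS.permActLinear_x η π, fun n π k l σ τ => NCS.repr_coproduct_x π σ τ⟩
  rw [NCS.repr_coproduct_x]
  simp only [le_top, true_and, NCS.moebius_top hn]
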